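/- Let $n,p\ge 1$ and let $f_1,\dots,f_n:\mathbb R^p\to\mathbb R$ be twice continuously differentiable, $f=\sum_{i=1}^n f_i$. Suppose there are $\mu,L>0$ and $M$ with $\mu I\preceq\nabla^2 f(x)\preceq MI$ and $\|\nabla^2 f(x)-\nabla^2 f(y)\|\le L\|x-y\|$ for all $x,y\in\mathbb R^p$ (spectral norm). Let $\mathcal G$ be a strongly connected directed network on the nodes $1,\dots,n$, whose nodes have distinct identifiers. **Flooding.** Each node $i$ starts with the set consisting of its own message, tagged with its identifier. In every round, simultaneously, each node sends to each of its (out-)neighbours $j$ one element of its current set, chosen arbitrarily, that it has not yet sent to $j$ (if there is one), and adds what it receives to its set. Two variants are allowed: (i) if $\mathcal G$ is undirected, the messages are sent along the edges of a fixed spanning tree of $\mathcal G$, a node moreover sends to $j$ only elements that it has not received from $j$, and there are $n-1$ rounds; (ii) the messages are sent along all edges of $\mathcal G$ and there are $n+d_{\mathcal G}-1$ rounds, where $d_{\mathcal G}$ is the diameter of $\mathcal G$. **DAN-LA.** Let $c>0$, $M_c=M+c$, $$\underline r=\tfrac13\sqrt{M_c^2+3\mu^2}-\tfrac{M_c}{3},\qquad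 \phi=\frac{2\mu(\mu-\underline r)^2}{L(M+\mu)}-\frac{2\underline r(\mu-\underline r)}{L}.$$ All nodes start at the same point $x_0^{(i)}=x_0\in\mathbb R^p$ with $H_{-1}^{(i)}=\hat H_{-1}^{(i)}=0$. At iteration $k=0,1,2,\dots$ every node $i$ does the following. 1. Let $\lambda_1,\lambda_2,\dots$ be the eigenvalues, with multiplicity, of $\nabla^2 f_i(x_k^{(i)})-H_{k-1}^{(i)}$ in order of decreasing magnitude ($\lambda_2:=0$ if $p=1$; ties are broken arbitrarily) and $w_1$ a unit eigenvector for $\lambda_1$. Set $h_k^{(i)}=\sqrt{|\lambda_1|}\,w_1$, $s_k^{(i)}=\operatorname{sign}(\lambda_1)$, $r_k^{(i)}=|\lambda_2|$. 2. Set $H_k^{(i)}=H_{k-1}^{(i)}+s_k^{(i)}h_k^{(i)}(h_k^{(i)})^{\mathsf T}$ and $g_k^{(i)}=\nabla f_i(x_k^{(i)})$. 3. Run the flooding, with the message $(r_k^{(i)},s_k^{(i)},g_k^{(i)},h_k^{(i)})$ at node $i$. Let $\mathcal S$ be the set of messages $(r,s,g,h)$, with their tags, that node $i$ has at the end, and set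 $\hat g_k^{(i)}=\sum_{\mathcal S}g$, $\hat H_k^{(i)}=\hat H_{k-1}^{(i)}+\sum_{\mathcal S}s\,hh^{\mathsf T}$, $\hat r_k^{(i)}=\sum_{\mathcal S}r$. 4. Set $\alpha_k^{(i)}=\min\{1,\phi/\|\hat g_k^{(i)}\|\}$ (that is $1$ if $\hat g_k^{(i)}=0$) if $\hat r_k^{(i)}\le\underline r$, and $\alpha_k^{(i)}=0$ otherwise. 5. Set $x_{k+1}^{(i)}=x_k^{(i)}$ if $\alpha_k^{(i)}=0$, and $x_{k+1}^{(i)}=x_k^{(i)}-\alpha_k^{(i)}(\hat H_k^{(i)})^{-1}\hat g_k^{(i)}$ otherwise. **Claim.** $f$ has a unique minimizer $x^\star$, and for every $c>0$, every starting point $x_0$, every execution of DAN-LA and every node $i$, the sequence $\|x_k^{(i)}-x^\star\|$ converges to $0$ R-superlinearly: there is a sequence of nonzero reals $e_k\to0$ with $|e_{k+1}|/|e_k|\to0$ and $\|x_k^{(i)}-x^\star\|\le|e_k|$ for all $k$. -/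

import Mathlib

namespace DistributedNewton

/-! ### Convergence rates -/

/-- `e` converges to `0` with a Q-superlinear rate: `e k → 0` and `|e (k+1)| / |e k| → 0`
(all terms nonzero, so that the quotients make sense). -/
def QSuperlinear (e : ℕ → ℝ) : Prop :=
  (∀ k, e k ≠ 0) ∧ Filter.Tendsto e Filter.atTop (nhds 0) ∧
    Filter.Tendsto (fun k => |e (k + 1)| / |e k|) Filter.atTop (nhds 0)

/-- `ε` converges to `0` with an R-superlinear rate: it is dominated, for every index, by a
Q-superlinearly convergent sequence. -/
def RSuperlinear (ε : ℕ → ℝ) : Prop :=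
  ∃ e : ℕ → ℝ, QSuperlinear e ∧ ∀ k, |ε k| ≤ |e k|

/-! ### Networks -/

/-- There is a directed path with exactly `t` edges from `i` to `j`. -/
def HasPath {n : ℕ} (G : Digraph (Fin n)) : ℕ → Fin n → Fin n → Prop
  | 0, i, j => i = j
  | t + 1, i, j => ∃ l, HasPath G t i l ∧ G.Adj l j

/-- Every node is joined to every node by a directed path. -/
def StronglyConnected {n : ℕ} (G : Digraph (Fin n)) : Prop :=
  ∀ i j, ∃ t, HasPath G t i j

/-- The number of edges in a shortest directed path from `i` to `j`. -/
noncomputable def distance {n : ℕ} (G : Digraph (Fin n)) (i j : Fin n) : ℕ :=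
  sInf {t | HasPath G t i j}

/-- The largest distance between any pair of nodes. -/
noncomputable def diameter {n : ℕ} (G : Digraph (Fin n)) : ℕ :=
  Finset.univ.sup fun ij : Fin n × Fin n => distance G ij.1 ij.2

/-- The two variants of distributed selective flooding on the network `G`
(`G.Adj i j` means that node `i` can directly send messages to node `j`).
* `undirected`: `G` is undirected, and the flooding is run along a spanning tree `T` of `G`.
* `directed`: the flooding is run along all edges of `G`. -/
inductive Protocol {n : ℕ} (G : Digraph (Fin n)) : Type
  | undirected (T : SimpleGraph (Fin n)) (symm : ∀ i j, G.Adj i j → G.Adj j i)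
      (spanning : ∀ i j, T.Adj i j → G.Adj i j) (tree : T.IsTree) : Protocol G
  | directed : Protocol G

/-- The links used by the protocol. -/
def Protocol.Link {n : ℕ} {G : Digraph (Fin n)} : Protocol G → Fin n → Fin n → Prop
  | .undirected T _ _ _, i, j => T.Adj i j
  | .directed, i, j => G.Adj i j

/-- The number of communication rounds in one execution of the flooding. -/
noncomputable def Protocol.rounds {n : ℕ} {G : Digraph (Fin n)} : Protocol G → ℕ
  | .undirected _ _ _ _ => n - 1
  | .directed => n + diameter G - 1

/-- `P.Eligible known sent t i j e`: after `t` rounds, node `i` may select the element `e` for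
sending it to node `j`, i.e. node `i` has `e`, has not sent it to `j` before and, in the
undirected variant, has not received it from `j` before. Here `known t i` is the information of
node `i` after `t` rounds and `sent t i j` is what `i` sends to `j` in the following round. -/
def Protocol.Eligible {n : ℕ} {G : Digraph (Fin n)} {α : Type*} (P : Protocol G)
    (known : ℕ → Fin n → Finset α) (sent : ℕ → Fin n → Fin n → Option α)
    (t : ℕ) (i j : Fin n) (e : α) : Prop :=
  e ∈ known t i ∧ (∀ l < t, sent l i j ≠ some e) ∧
    match P with
    | .undirected _ _ _ _ => ∀ l < t, sent l j i ≠ some e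
    | .directed => True

/-- An execution of the flooding in which node `i` starts with the message `S i`. In every round,
over every link, a node sends an arbitrary eligible element if there is one, and nothing else. -/
structure Protocol.IsRun {n : ℕ} {G : Digraph (Fin n)} {α : Type*} (P : Protocol G)
    (S : Fin n → α) (known : ℕ → Fin n → Finset α) (sent : ℕ → Fin n → Fin n → Option α) :
    Prop where
  init : ∀ i, known 0 i = {S i}
  sends_eligible : ∀ t i j e, sent t i j = some e → P.Link i j ∧ P.Eligible known sent t i j e
  sends_if_possible : ∀ t i j, P.Link i j → sent t i j = none →
    ∀ e, ¬ P.Eligible known sent t i j e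
  receives : ∀ t i e, e ∈ known (t + 1) i ↔ e ∈ known t i ∨ ∃ j, sent t j i = some e

/-! ### The algorithm -/

/-- The Hessian of `f` at `x`, as a linear operator; its operator norm is the spectral norm. -/
noncomputable def hessian {p : ℕ} (f : EuclideanSpace ℝ (Fin p) → ℝ)
    (x : EuclideanSpace ℝ (Fin p)) :
    EuclideanSpace ℝ (Fin p) →L[ℝ] EuclideanSpace ℝ (Fin p) :=
  fderiv ℝ (gradient f) x

/-- The rank-one operator `s • h hᵀ`. -/
noncomputable def signedOuter {p : ℕ} (s : ℝ) (h : EuclideanSpace ℝ (Fin p)) :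
    EuclideanSpace ℝ (Fin p) →L[ℝ] EuclideanSpace ℝ (Fin p) :=
  s • InnerProductSpace.rankOne ℝ h h

/-- `(s, h, r)` is a result of the rank-one eigen-approximation of the symmetric operator `A`:
for eigenvalues `lam 0, lam 1, …` of `A` (with multiplicity, in order of decreasing magnitude) and
orthonormal eigenvectors `w 0, w 1, …`, one has `h = √|lam 0| w 0`, `s = sign (lam 0)` and
`r = |lam 1|` (which is read as `0` in dimension one). Ties are broken arbitrarily. -/
def IsRankOneApprox {p : ℕ} [NeZero p]
    (A : EuclideanSpace ℝ (Fin p) →L[ℝ] EuclideanSpace ℝ (Fin p))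
    (s : ℝ) (h : EuclideanSpace ℝ (Fin p)) (r : ℝ) : Prop :=
  ∃ (lam : Fin p → ℝ) (w : OrthonormalBasis (Fin p) ℝ (EuclideanSpace ℝ (Fin p))),
    (∀ j, A (w j) = lam j • w j) ∧ Antitone (fun j => |lam j|) ∧
    h = √|lam 0| • w 0 ∧ s = Real.sign (lam 0) ∧
    r = if hp : 1 < p then |lam ⟨1, hp⟩| else 0

/-- The threshold `r̲ = (√(M_c² + 3μ²) - M_c) / 3` with `M_c = M + c`. -/
noncomputable def threshold (μ M c : ℝ) : ℝ :=
  1 / 3 * √((M + c) ^ 2 + 3 * μ ^ 2) - (M + c) / 3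

/-- The constant `φ = 2μ(μ - r̲)² / (L(M + μ)) - 2r̲(μ - r̲) / L`. -/
noncomputable def phi (μ L M c : ℝ) : ℝ :=
  2 * μ * (μ - threshold μ M c) ^ 2 / (L * (M + μ)) -
    2 * threshold μ M c * (μ - threshold μ M c) / L

open Classical in
/-- The stepsize: `min {1, φ / ‖g‖}` (that is `1` if `g = 0`) if the error bound `r` is at most
the threshold, and `0` otherwise. -/
noncomputable def stepsize {p : ℕ} (μ L M c r : ℝ) (g : EuclideanSpace ℝ (Fin p)) : ℝ :=
  if r ≤ threshold μ M c then (if g = 0 then 1 else min 1 (phi μ L M c / ‖g‖)) else 0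

/-- The message `(r, s, g, h)` that a node shares. -/
structure Message (p : ℕ) where
  r : ℝ
  s : ℝ
  g : EuclideanSpace ℝ (Fin p)
  h : EuclideanSpace ℝ (Fin p)

open Classical in
/-- An execution of DAN-LA from the common starting point `x₀`. Node `i` has the local objective
`f i` and the identifier `ident i`, which is attached to its messages. The sequences `H` and
`Hhat` of local and global Hessian estimates are shifted by one: `H k i` and `Hhat k i` are the
estimates available before iteration `k`, and `H (k + 1) i`, `Hhat (k + 1) i` those computed in
iteration `k`. -/
structure DANLA {n p : ℕ} [NeZero p] {ι : Type*} {G : Digraph (Fin n)} (P : Protocol G)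
    (ident : Fin n → ι) (f : Fin n → EuclideanSpace ℝ (Fin p) → ℝ) (μ L M c : ℝ)
    (x₀ : EuclideanSpace ℝ (Fin p)) where
  /-- decision vectors -/
  x : ℕ → Fin n → EuclideanSpace ℝ (Fin p)
  /-- local gradients -/
  g : ℕ → Fin n → EuclideanSpace ℝ (Fin p)
  /-- vectors of the rank-one approximations -/
  h : ℕ → Fin n → EuclideanSpace ℝ (Fin p)
  /-- signs of the rank-one approximations -/
  s : ℕ → Fin n → ℝ
  /-- local approximation errors -/
  r : ℕ → Fin n → ℝ
  /-- local Hessian estimates -/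
  H : ℕ → Fin n → EuclideanSpace ℝ (Fin p) →L[ℝ] EuclideanSpace ℝ (Fin p)
  /-- `known k t i`: the tagged messages at node `i` after `t` rounds in iteration `k` -/
  known : ℕ → ℕ → Fin n → Finset (ι × Message p)
  /-- `sent k t i j`: what node `i` sends to node `j` after `t` rounds in iteration `k` -/
  sent : ℕ → ℕ → Fin n → Fin n → Option (ι × Message p)
  /-- gradients assembled by the nodes -/
  ghat : ℕ → Fin n → EuclideanSpace ℝ (Fin p)
  /-- global Hessian estimates of the nodes -/
  Hhat : ℕ → Fin n → EuclideanSpace ℝ (Fin p) →L[ℝ] EuclideanSpace ℝ (Fin p)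
  /-- accumulated approximation errors -/
  rhat : ℕ → Fin n → ℝ
  /-- stepsizes -/
  α : ℕ → Fin n → ℝ
  x_zero : ∀ i, x 0 i = x₀
  H_zero : ∀ i, H 0 i = 0
  Hhat_zero : ∀ i, Hhat 0 i = 0
  rankOne : ∀ k i, IsRankOneApprox (hessian (f i) (x k i) - H k i) (s k i) (h k i) (r k i)
  H_succ : ∀ k i, H (k + 1) i = H k i + signedOuter (s k i) (h k i)
  g_eq : ∀ k i, g k i = gradient (f i) (x k i)
  flooding : ∀ k, P.IsRun (fun u => (ident u, ⟨r k u, s k u, g k u, h k u⟩)) (known k) (sent k)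
  ghat_eq : ∀ k i, ghat k i = ∑ m ∈ known k P.rounds i, m.2.g
  Hhat_succ : ∀ k i,
    Hhat (k + 1) i = Hhat k i + ∑ m ∈ known k P.rounds i, signedOuter m.2.s m.2.h
  rhat_eq : ∀ k i, rhat k i = ∑ m ∈ known k P.rounds i, m.2.r
  α_eq : ∀ k i, α k i = stepsize μ L M c (rhat k i) (ghat k i)
  x_succ : ∀ k i, x (k + 1) i =
    if α k i = 0 then x k i else x k i - α k i • (Hhat (k + 1) i).inverse (ghat k i)

end DistributedNewton

/-! Flooding brings every message to every node (`known_rounds_eq`). All nodes therefore keep a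
common iterate and use the exact gradient of the sum, the sum of the local Hessian estimates and the
sum of the local errors (`x_eq`, `Hhat_eq_sum`). What remains is a single inexact damped Newton
method.

The accumulated error `rhat` bounds the distance between the Hessian and its estimate. It is itself
controlled by the motion of the iterates: any operator has rank at most `p`, each deflation lowers
the rank by one, and each change of a local Hessian perturbs the operator by its norm. So `p`
iterations later only the Hessian drift in between is left (`remainder_le_sum_drift`).

If `rhat` is at most the threshold, `φ` is chosen so that a step of length `α` multiplies the
gradient norm by at most `1 - α (1 - μ / (M + μ))`. Steps cannot stop forever, because without
motion there is no drift and `rhat` drops to zero. Hence the gradient tends to zero and the iterates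
converge. Only then does the drift, and with it `rhat`, tend to zero; full steps are eventually
taken and the contraction factor itself tends to zero (`rSuperlinear_of_inexact_newton`). -/

namespace DistributedNewton

/-! ### Flooding -/

section Flooding

variable {n : ℕ} {G : Digraph (Fin n)} {α : Type*}

open Classical in
/-- The elements that `i` has sent to `j` in the first `t` rounds. -/
noncomputable def sentSet (sent : ℕ → Fin n → Fin n → Option α) (t : ℕ) (i j : Fin n) :
    Finset α :=
  (Finset.range t).biUnion fun l => (sent l i j).toFinset

theorem mem_sentSet {sent : ℕ → Fin n → Fin n → Option α} {t : ℕ} {i j : Fin n} {e : α} :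
    e ∈ sentSet sent t i j ↔ ∃ l < t, sent l i j = some e := by
  simp [sentSet]

theorem sentSet_subset_succ (sent : ℕ → Fin n → Fin n → Option α) (t : ℕ) (i j : Fin n) :
    sentSet sent t i j ⊆ sentSet sent (t + 1) i j := fun _ he =>
  let ⟨l, hl, h⟩ := mem_sentSet.1 he
  mem_sentSet.2 ⟨l, hl.trans (Nat.lt_succ_self t), h⟩

namespace Protocol.IsRun

variable {P : Protocol G} {S : Fin n → α} {known : ℕ → Fin n → Finset α}
  {sent : ℕ → Fin n → Fin n → Option α}

theorem known_mono (h : P.IsRun S known sent) (i : Fin n) : Monotone fun t => known t i :=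
  monotone_nat_of_le_succ fun t _ he => (h.receives t i _).2 (.inl he)

theorem own_mem_known (h : P.IsRun S known sent) (t : ℕ) (i : Fin n) : S i ∈ known t i :=
  h.known_mono i (Nat.zero_le t) (by simp [h.init])

theorem sentSet_subset_known_receiver (h : P.IsRun S known sent) (t : ℕ) (i j : Fin n) :
    sentSet sent t i j ⊆ known t j := by
  intro e he
  obtain ⟨l, hl, hs⟩ := mem_sentSet.1 he
  exact h.known_mono j (Nat.succ_le_of_lt hl) ((h.receives l j e).2 (.inr ⟨i, hs⟩))

theorem mem_known_iff (h : P.IsRun S known sent) (t : ℕ) (i : Fin n) (e : α) :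
    e ∈ known t i ↔ e = S i ∨ ∃ j, e ∈ sentSet sent t j i := by
  induction t with
  | zero => simp [h.init, mem_sentSet]
  | succ t ih =>
    rw [h.receives, ih, or_assoc, ← exists_or]
    refine or_congr_right (exists_congr fun j => ?_)
    simp only [mem_sentSet, Nat.lt_succ_iff_lt_or_eq, or_and_right, exists_or, exists_eq_left]

theorem exists_eq_of_mem_known (h : P.IsRun S known sent) {t : ℕ} {i : Fin n} {e : α}
    (he : e ∈ known t i) : ∃ l, S l = e := by
  induction t generalizing i with
  | zero => exact ⟨i, by simpa [h.init, eq_comm] using he⟩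
  | succ t ih =>
    rcases (h.receives t i e).1 he with he | ⟨j, hj⟩
    · exact ih he
    · exact ih (h.sends_eligible t j i e hj).2.1

/-- In every round, a node sends something new over a link or has nothing left to send. -/
theorem card_sentSet_succ_or (h : P.IsRun S known sent) (t : ℕ) {i j : Fin n} (hij : P.Link i j) :
    (sentSet sent t i j).card + 1 ≤ (sentSet sent (t + 1) i j).card ∨
      ∀ e, ¬ P.Eligible known sent t i j e := by
  cases hs : sent t i j with
  | none => exact .inr (h.sends_if_possible t i j hij hs)
  | some e =>
    refine .inl (Finset.card_lt_card ?_)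
    refine (Finset.ssubset_iff_of_subset (sentSet_subset_succ sent t i j)).2
      ⟨e, mem_sentSet.2 ⟨t, Nat.lt_succ_self t, hs⟩, fun he => ?_⟩
    obtain ⟨l, hl, hl'⟩ := mem_sentSet.1 he
    exact (h.sends_eligible t i j e hs).2.2.1 l hl hl'

/-- A node with at least `n` elements knows everything. -/
theorem mem_known_of_card_le (h : P.IsRun S known sent) {t : ℕ} {i : Fin n}
    (hn : n ≤ (known t i).card) (l : Fin n) : S l ∈ known t i := by
  classical
  have hsub : known t i ⊆ Finset.univ.image S := fun e he => by
    simpa using h.exists_eq_of_mem_known he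
  have := Finset.eq_of_subset_of_card_le hsub
    (Finset.card_image_le.trans (by simpa using hn))
  rw [this]
  exact Finset.mem_image_of_mem S (Finset.mem_univ l)

end Protocol.IsRun

/-! #### Flooding over all links -/

/-- Pipelining: a link carries something new in each round until its tail has nothing left to send,
and a distance of `s` costs at most `s` rounds of delay. With `s` the diameter and `t + 1 = n + s`,
the first alternative means that `n` messages are known. -/
theorem Protocol.IsRun.card_known_or_of_directed {S : Fin n → α} {known : ℕ → Fin n → Finset α}
    {sent : ℕ → Fin n → Fin n → Option α}
    (h : (Protocol.directed : Protocol G).IsRun S known sent) (s t : ℕ) (i : Fin n) :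
    t + 1 ≤ (known t i).card + s ∨ ∀ l, ∀ u ≤ s, HasPath G u l i → S l ∈ known t i := by
  induction s generalizing t i with
  | zero =>
    right
    intro l u hu hl
    obtain rfl : u = 0 := by omega
    obtain rfl : l = i := hl
    exact h.own_mem_known t l
  | succ s ih =>
    -- The same alternative for a single link. If the link falls idle, `j` has sent all it knows, so
    -- the induction hypothesis at `j` transfers to the set of sent messages.
    have key : ∀ j, G.Adj j i → ∀ t, t ≤ (sentSet sent t j i).card + s ∨
        ∀ l, ∀ u ≤ s, HasPath G u l j → S l ∈ sentSet sent t j i := by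
      intro j hj t
      induction t with
      | zero => exact .inl (Nat.zero_le _)
      | succ t iht =>
        rcases iht with iht | iht
        · rcases h.card_sentSet_succ_or t (show Protocol.directed.Link j i from hj) with hc | hc
          · left; omega
          · have hsub : known t j ⊆ sentSet sent (t + 1) j i := by
              intro e he
              by_contra hne
              exact hc e ⟨he, fun l hl hs =>
                hne (mem_sentSet.2 ⟨l, hl.trans (Nat.lt_succ_self t), hs⟩), trivial⟩
            rcases ih t j with h' | h'
            · have := Finset.card_le_card hsub
              left; omega
            · exact .inr fun l u hu hp => hsub (h' l u hu hp)
        · exact .inr fun l u hu hp => sentSet_subset_succ sent t j i (iht l u hu hp)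
    by_cases hex : ∃ j, G.Adj j i ∧ t ≤ (sentSet sent t j i).card + s
    · obtain ⟨j, _, hj⟩ := hex
      have := Finset.card_le_card (h.sentSet_subset_known_receiver t j i)
      left; omega
    · push Not at hex
      right
      rintro l (_ | u) hu hp
      · obtain rfl : l = i := hp
        exact h.own_mem_known t l
      · obtain ⟨j, hlj, hji⟩ := hp
        rcases key j hji t with hk | hk
        · exact absurd hk (not_le.2 (hex j hji))
        · exact h.sentSet_subset_known_receiver t j i (hk l u (by omega) hlj)

theorem Protocol.IsRun.mem_known_of_directed {S : Fin n → α} {known : ℕ → Fin n → Finset α}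
    {sent : ℕ → Fin n → Fin n → Option α} (hG : StronglyConnected G)
    (h : (Protocol.directed : Protocol G).IsRun S known sent) (i l : Fin n) :
    S l ∈ known (n + diameter G - 1) i := by
  have hn : 0 < n := i.pos
  rcases h.card_known_or_of_directed (diameter G) (n + diameter G - 1) i with hc | hc
  · exact h.mem_known_of_card_le (by omega) l
  · exact hc l (distance G l i)
      (Finset.le_sup (f := fun ij : Fin n × Fin n => distance G ij.1 ij.2) (Finset.mem_univ (l, i)))
      (Nat.sInf_mem (hG l i))

/-! #### Flooding along a spanning tree -/

/-- In a tree, a vertex `i ≠ l` has exactly one neighbour that is closer to `l`. -/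
theorem _root_.SimpleGraph.IsTree.eq_of_adj_of_dist_lt {V : Type*} {T : SimpleGraph V}
    (hT : T.IsTree) {l i j k : V} (hj : T.Adj j i) (hk : T.Adj k i)
    (hdj : T.dist l j < T.dist l i) (hdk : T.dist l k < T.dist l i) : j = k := by
  have path : ∀ v, T.Adj v i → T.dist l v < T.dist l i →
      ∃ q : T.Walk l i, q.IsPath ∧ q.penultimate = v := by
    intro v hv hd
    obtain ⟨q, hq⟩ := hT.1.exists_walk_length_eq_dist l v
    refine ⟨q.concat hv, SimpleGraph.Walk.isPath_of_length_eq_dist _ ?_, by simp⟩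
    have h1 := T.dist_le (q.concat hv)
    rw [SimpleGraph.Walk.length_concat] at h1 ⊢
    omega
  obtain ⟨q, hq, rfl⟩ := path j hj hdj
  obtain ⟨q', hq', rfl⟩ := path k hk hdk
  rw [(hT.existsUnique_path l i).unique hq hq']

theorem _root_.SimpleGraph.Connected.exists_adj_dist_lt {V : Type*} {T : SimpleGraph V}
    (hT : T.Connected) {l i : V} (hli : l ≠ i) : ∃ j, T.Adj j i ∧ T.dist l j < T.dist l i := by
  obtain ⟨q, hq⟩ := hT.exists_walk_length_eq_dist l i
  have hnil : ¬ q.Nil := fun hn => hli hn.eq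
  refine ⟨q.penultimate, q.adj_penultimate hnil, ?_⟩
  have h1 := T.dist_le q.dropLast
  have h2 : 0 < q.length := by
    rw [Nat.pos_iff_ne_zero]
    exact fun h0 => hli (SimpleGraph.Walk.eq_of_length_eq_zero h0)
  have h3 : q.dropLast.length = q.length - 1 := by
    simp
  omega

/-- Messages only travel away from their source: if `i` got the message from `k`, then `k` is the
one neighbour of `i` closer to the source, and `j ≠ k` because nothing is sent back. -/
theorem Protocol.IsRun.dist_lt_of_mem_sentSet {T : SimpleGraph (Fin n)}
    {symm : ∀ i j, G.Adj i j → G.Adj j i} {spanning : ∀ i j, T.Adj i j → G.Adj i j}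
    {tree : T.IsTree} {S : Fin n → α} (hS : Function.Injective S) {known : ℕ → Fin n → Finset α}
    {sent : ℕ → Fin n → Fin n → Option α}
    (h : (Protocol.undirected T symm spanning tree).IsRun S known sent)
    {t : ℕ} {i j l : Fin n} (hl : S l ∈ sentSet sent t i j) : T.dist l i < T.dist l j := by
  obtain ⟨t, -, hs⟩ := mem_sentSet.1 hl
  clear hl
  induction t using Nat.strong_induction_on generalizing i j with
  | _ t ih =>
    have hel := h.sends_eligible t i j _ hs
    have hij : T.Adj i j := hel.1
    rcases (h.mem_known_iff t i _).1 hel.2.1 with he | ⟨k, hk⟩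
    · obtain rfl := hS he
      rw [SimpleGraph.dist_self]
      exact tree.1.pos_dist_of_ne hij.ne
    · obtain ⟨u, hu, hsu⟩ := mem_sentSet.1 hk
      have hki : T.Adj k i := (h.sends_eligible u k i _ hsu).1
      have hkj : k ≠ j := by
        rintro rfl
        exact hel.2.2.2 u hu hsu
      by_contra hlt
      have hne := tree.dist_ne_of_adj l hij
      exact hkj (tree.eq_of_adj_of_dist_lt hki hij.symm (ih u hu hsu) (by omega))

/-- In a tree no round is lost: a link is productive in every round until all messages originating
on its tail's side have crossed it. -/
theorem Protocol.IsRun.card_sentSet_or_of_undirected {T : SimpleGraph (Fin n)}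
    {symm : ∀ i j, G.Adj i j → G.Adj j i} {spanning : ∀ i j, T.Adj i j → G.Adj i j}
    {tree : T.IsTree} {S : Fin n → α} (hS : Function.Injective S) {known : ℕ → Fin n → Finset α}
    {sent : ℕ → Fin n → Fin n → Option α}
    (h : (Protocol.undirected T symm spanning tree).IsRun S known sent) (t : ℕ) {i j : Fin n}
    (hij : T.Adj i j) :
    t ≤ (sentSet sent t i j).card ∨ ∀ l, T.dist l i < T.dist l j → S l ∈ sentSet sent t i j := by
  classical
  induction t generalizing i j with
  | zero => exact .inl (Nat.zero_le _)
  | succ t ih =>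
    rcases ih hij with hc | hc
    · rcases h.card_sentSet_succ_or t
        (show (Protocol.undirected T symm spanning tree).Link i j from hij) with hc' | hc'
      · left; omega
      · have hsub : ∀ l, S l ∈ known t i → S l ∉ sentSet sent t j i →
            S l ∈ sentSet sent (t + 1) i j := by
          intro l he hni
          by_contra hne
          exact hc' (S l) ⟨he,
            fun u hu hs => hne (mem_sentSet.2 ⟨u, hu.trans (Nat.lt_succ_self t), hs⟩),
            fun u hu hs => hni (mem_sentSet.2 ⟨u, hu, hs⟩)⟩
        have hown : S i ∈ sentSet sent (t + 1) i j :=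
          hsub i (h.own_mem_known t i) fun hi => by
            have := h.dist_lt_of_mem_sentSet hS hi
            simp at this
        have hother : ∀ k, T.Adj k i → k ≠ j → ∀ l, S l ∈ sentSet sent t k i →
            S l ∈ sentSet sent (t + 1) i j := fun k hk hkj l hl =>
          hsub l (h.sentSet_subset_known_receiver t k i hl) fun hl' =>
            hkj (tree.eq_of_adj_of_dist_lt hk hij.symm (h.dist_lt_of_mem_sentSet hS hl)
              (h.dist_lt_of_mem_sentSet hS hl'))
        by_cases hex : ∃ k, T.Adj k i ∧ k ≠ j ∧ t ≤ (sentSet sent t k i).card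
        · obtain ⟨k, hk, hkj, hcard⟩ := hex
          -- The `t` messages that came in from `k` and the message of `i` itself make `t + 1`, all
          -- of which have been passed on to `j`.
          left
          have hni : S i ∉ sentSet sent t k i := fun hi => by
            have := h.dist_lt_of_mem_sentSet hS hi
            simp at this
          have hle : insert (S i) (sentSet sent t k i) ⊆ sentSet sent (t + 1) i j := by
            intro e he
            rcases Finset.mem_insert.1 he with rfl | he
            · exact hown
            · obtain ⟨l, rfl⟩ :=
                h.exists_eq_of_mem_known (h.sentSet_subset_known_receiver t k i he)
              exact hother k hk hkj l he
          have := Finset.card_le_card hle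
          rw [Finset.card_insert_of_notMem hni] at this
          omega
        · push Not at hex
          right
          intro l hl
          by_cases hli : l = i
          · exact hli ▸ hown
          · obtain ⟨k, hk, hkd⟩ := tree.1.exists_adj_dist_lt hli
            have hkj : k ≠ j := by
              rintro rfl
              omega
            rcases ih hk with hk' | hk'
            · exact absurd hk' (not_le.2 (hex k hk hkj))
            · exact hother k hk hkj l (hk' l hkd)
    · exact .inr fun l hl => sentSet_subset_succ sent t i j (hc l hl)

theorem Protocol.IsRun.mem_known_of_undirected {T : SimpleGraph (Fin n)}
    {symm : ∀ i j, G.Adj i j → G.Adj j i} {spanning : ∀ i j, T.Adj i j → G.Adj i j}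
    {tree : T.IsTree} {S : Fin n → α} (hS : Function.Injective S) {known : ℕ → Fin n → Finset α}
    {sent : ℕ → Fin n → Fin n → Option α}
    (h : (Protocol.undirected T symm spanning tree).IsRun S known sent) (i l : Fin n) :
    S l ∈ known (n - 1) i := by
  classical
  by_cases hli : l = i
  · exact hli ▸ h.own_mem_known _ _
  · obtain ⟨k, hk, hkd⟩ := tree.1.exists_adj_dist_lt hli
    rcases h.card_sentSet_or_of_undirected hS (n - 1) hk with hc | hc
    -- The `n - 1` messages received from `k` do not include the one of `i`, so `i` has `n` in
    -- total.
    · have hni : S i ∉ sentSet sent (n - 1) k i := fun hi => by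
        have := h.dist_lt_of_mem_sentSet hS hi
        simp at this
      have hle := Finset.card_le_card (Finset.insert_subset (h.own_mem_known (n - 1) i)
        (h.sentSet_subset_known_receiver (n - 1) k i))
      rw [Finset.card_insert_of_notMem hni] at hle
      exact h.mem_known_of_card_le (by omega) l
    · exact h.sentSet_subset_known_receiver _ k i (hc l hkd)

open Classical in
/-- At the end of the flooding every node has all messages. -/
theorem Protocol.IsRun.known_rounds_eq {P : Protocol G} {S : Fin n → α}
    (hS : Function.Injective S) {known : ℕ → Fin n → Finset α}
    {sent : ℕ → Fin n → Fin n → Option α} (hG : StronglyConnected G)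
    (h : P.IsRun S known sent) (i : Fin n) :
    known P.rounds i = Finset.univ.image S := by
  ext e
  refine ⟨fun he => by simpa using h.exists_eq_of_mem_known he, fun he => ?_⟩
  obtain ⟨l, -, rfl⟩ := Finset.mem_image.1 he
  cases P with
  | undirected T symm spanning tree => exact h.mem_known_of_undirected hS i l
  | directed => exact h.mem_known_of_directed hG i l

/-- Injectivity, which comes from the identifiers, prevents equal messages of different nodes from
merging in the set. -/
theorem Protocol.IsRun.sum_known_rounds {P : Protocol G} {S : Fin n → α}
    (hS : Function.Injective S) {known : ℕ → Fin n → Finset α}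
    {sent : ℕ → Fin n → Fin n → Option α} (hG : StronglyConnected G)
    (h : P.IsRun S known sent) {E : Type*} [AddCommMonoid E] (φ : α → E) (i : Fin n) :
    ∑ m ∈ known P.rounds i, φ m = ∑ l, φ (S l) := by
  classical
  rw [h.known_rounds_eq hS hG i, Finset.sum_image fun _ _ _ _ e => hS e]

end Flooding

/-! ### Rank-one approximations of symmetric operators -/

section RankOne

variable {p : ℕ}

local notation "𝔼" => EuclideanSpace ℝ (Fin p)

theorem inner_apply_of_eigenbasis {A : 𝔼 →L[ℝ] 𝔼} {lam : Fin p → ℝ}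
    {w : OrthonormalBasis (Fin p) ℝ 𝔼} (hA : ∀ j, A (w j) = lam j • w j) (v : 𝔼) (j : Fin p) :
    inner ℝ (w j) (A v) = lam j * inner ℝ (w j) v := by
  have hv : A v = ∑ i, (inner ℝ (w i) v * lam i) • w i := by
    conv_lhs => rw [← w.sum_repr' v]
    simp [map_sum, hA, smul_smul]
  rw [hv, w.orthonormal.inner_right_fintype, mul_comm]

theorem norm_sq_apply_of_eigenbasis {A : 𝔼 →L[ℝ] 𝔼} {lam : Fin p → ℝ}
    {w : OrthonormalBasis (Fin p) ℝ 𝔼} (hA : ∀ j, A (w j) = lam j • w j) (v : 𝔼) :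
    ‖A v‖ ^ 2 = ∑ j, lam j ^ 2 * inner ℝ (w j) v ^ 2 := by
  rw [← w.sum_sq_norm_inner_right (A v)]
  refine Finset.sum_congr rfl fun j _ => ?_
  rw [inner_apply_of_eigenbasis hA, Real.norm_eq_abs, sq_abs, mul_pow]

theorem opNorm_le_of_eigenbasis {A : 𝔼 →L[ℝ] 𝔼} {lam : Fin p → ℝ}
    {w : OrthonormalBasis (Fin p) ℝ 𝔼} (hA : ∀ j, A (w j) = lam j • w j) {r : ℝ} (hr : 0 ≤ r)
    (hlam : ∀ j, |lam j| ≤ r) : ‖A‖ ≤ r := by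
  refine A.opNorm_le_bound hr fun v => ?_
  refine le_of_sq_le_sq ?_ (by positivity)
  rw [norm_sq_apply_of_eigenbasis hA, mul_pow, ← w.sum_sq_norm_inner_right v, Finset.mul_sum]
  refine Finset.sum_le_sum fun j _ => ?_
  rw [Real.norm_eq_abs, sq_abs]
  exact mul_le_mul_of_nonneg_right (sq_le_sq.2 ((hlam j).trans (le_abs_self r))) (sq_nonneg _)

/-- `A` has distance at most `ε` from an operator of rank at most `m`. -/
def RankApprox (m : ℕ) (ε : ℝ) (A : 𝔼 →L[ℝ] 𝔼) : Prop :=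
  ∃ R : 𝔼 →L[ℝ] 𝔼, Module.finrank ℝ (LinearMap.range (R : 𝔼 →ₗ[ℝ] 𝔼)) ≤ m ∧ ‖A - R‖ ≤ ε

theorem rankApprox_self (A : 𝔼 →L[ℝ] 𝔼) : RankApprox p 0 A :=
  ⟨A, (Submodule.finrank_le _).trans (by simp), by simp⟩

theorem RankApprox.add {m : ℕ} {ε : ℝ} {A : 𝔼 →L[ℝ] 𝔼} (h : RankApprox m ε A)
    (D : 𝔼 →L[ℝ] 𝔼) : RankApprox m (ε + ‖D‖) (A + D) := by
  obtain ⟨R, hR, hA⟩ := h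
  refine ⟨R, hR, ?_⟩
  rw [add_sub_right_comm]
  exact (norm_add_le _ _).trans (by gcongr)

theorem RankApprox.norm_le {ε : ℝ} {A : 𝔼 →L[ℝ] 𝔼} (h : RankApprox 0 ε A) : ‖A‖ ≤ ε := by
  obtain ⟨R, hR, hA⟩ := h
  have h0 : (R : 𝔼 →ₗ[ℝ] 𝔼) = 0 := by
    rw [← LinearMap.range_eq_bot, ← Submodule.finrank_eq_zero (R := ℝ)]
    exact Nat.le_zero.1 hR
  have h1 : R = 0 := by
    ext1 v
    exact LinearMap.congr_fun h0 v
  simpa [h1] using hA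

/-- The easy half of the Eckart–Young theorem. -/
theorem RankApprox.abs_eigenvalue_le {m : ℕ} {ε : ℝ} {A : 𝔼 →L[ℝ] 𝔼} (h : RankApprox m ε A)
    {lam : Fin p → ℝ} {w : OrthonormalBasis (Fin p) ℝ 𝔼} (hA : ∀ j, A (w j) = lam j • w j)
    (hlam : Antitone fun j => |lam j|) {j : Fin p} (hj : m ≤ j) : |lam j| ≤ ε := by
  obtain ⟨R, hR, hAR⟩ := h
  -- Dimension count: the span of the leading `j + 1 > m` eigenvectors meets the kernel of `R`. On
  -- that span `A` stretches by at least `|lam j|`, while on the kernel `A = A - R`.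
  obtain ⟨v, hvW, hvK, hv0⟩ : ∃ v ∈ Submodule.span ℝ (Set.range fun i : Fin (j + 1) =>
      w (Fin.castLE j.isLt i)), R v = 0 ∧ v ≠ 0 := by
    by_contra hcon
    push Not at hcon
    have hdisj : Disjoint (Submodule.span ℝ (Set.range fun i : Fin (j + 1) =>
        w (Fin.castLE j.isLt i))) (LinearMap.ker (R : 𝔼 →ₗ[ℝ] 𝔼)) :=
      Submodule.disjoint_def.2 fun v hv hk => hcon v hv hk
    have h1 := Submodule.finrank_add_finrank_le_of_disjoint hdisj
    have h2 := LinearMap.finrank_range_add_finrank_ker (R : 𝔼 →ₗ[ℝ] 𝔼)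
    have hli : LinearIndependent ℝ fun i : Fin (j + 1) => w (Fin.castLE j.isLt i) :=
      w.orthonormal.linearIndependent.comp _ (Fin.castLE_injective _)
    rw [finrank_span_eq_card hli, Fintype.card_fin] at h1
    omega
  have hcoord : ∀ i, j < i → inner ℝ (w i) v = 0 := by
    intro i hi
    have hle : Submodule.span ℝ (Set.range fun i : Fin (j + 1) => w (Fin.castLE j.isLt i)) ≤
        LinearMap.ker (innerSL ℝ (w i)).toLinearMap := by
      rw [Submodule.span_le]
      rintro _ ⟨l, rfl⟩
      refine w.orthonormal.2 fun hil => ?_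
      have h1 := l.isLt
      have h2 : (i : ℕ) = l := congrArg Fin.val hil
      have h3 : (j : ℕ) < i := hi
      omega
    exact hle hvW
  have hlow : (|lam j| * ‖v‖) ^ 2 ≤ ‖A v‖ ^ 2 := by
    rw [norm_sq_apply_of_eigenbasis hA, mul_pow, ← w.sum_sq_norm_inner_right v, Finset.mul_sum]
    refine Finset.sum_le_sum fun i _ => ?_
    rw [Real.norm_eq_abs, sq_abs, sq_abs]
    rcases le_or_gt i j with hij | hij
    · exact mul_le_mul_of_nonneg_right (sq_le_sq.2 (hlam hij)) (sq_nonneg _)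
    · simp [hcoord i hij]
  have hup : ‖A v‖ ≤ ε * ‖v‖ := by
    have : (A - R) v = A v := by simp [hvK]
    rw [← this]
    exact (A - R).le_of_opNorm_le hAR v
  exact le_of_mul_le_mul_right ((le_of_sq_le_sq hlow (norm_nonneg _)).trans hup)
    (norm_pos_iff.2 hv0)

theorem signedOuter_of_eigenvalue (a : ℝ) (v : 𝔼) :
    signedOuter (Real.sign a) (√|a| • v) = a • InnerProductSpace.rankOne ℝ v v := by
  ext1 u
  simp only [signedOuter, smul_apply, InnerProductSpace.rankOne_apply,
    real_inner_smul_left, smul_smul]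
  congr 1
  have h1 : √|a| * √|a| = |a| := Real.mul_self_sqrt (abs_nonneg a)
  have h2 : Real.sign a * |a| = a := by
    rcases lt_trichotomy a 0 with h | h | h
    · rw [Real.sign_of_neg h, abs_of_neg h]; ring
    · simp [h]
    · rw [Real.sign_of_pos h, abs_of_pos h]; ring
  linear_combination (Real.sign a * inner ℝ v u) * h1 + inner ℝ v u * h2

variable [NeZero p]

/-- Deflation: the remainder of the rank-one approximation has the same eigenvectors, with the
leading eigenvalue replaced by zero. -/
theorem sub_signedOuter_apply {A : 𝔼 →L[ℝ] 𝔼} {lam : Fin p → ℝ}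
    {w : OrthonormalBasis (Fin p) ℝ 𝔼} (hA : ∀ j, A (w j) = lam j • w j) (j : Fin p) :
    (A - signedOuter (Real.sign (lam 0)) (√|lam 0| • w 0)) (w j) =
      (if j = 0 then 0 else lam j) • w j := by
  rw [signedOuter_of_eigenvalue, sub_apply, hA,
    smul_apply, InnerProductSpace.rankOne_apply,
    orthonormal_iff_ite.1 w.orthonormal]
  by_cases hj : j = 0
  · subst hj; simp
  · simp [hj, Ne.symm hj]

theorem IsRankOneApprox.norm_sub_le {A : 𝔼 →L[ℝ] 𝔼} {s r : ℝ} {h : 𝔼}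
    (hap : IsRankOneApprox A s h r) : ‖A - signedOuter s h‖ ≤ r := by
  obtain ⟨lam, w, hA, hlam, rfl, rfl, rfl⟩ := hap
  refine opNorm_le_of_eigenbasis (sub_signedOuter_apply hA) (by split_ifs <;> simp) fun j => ?_
  by_cases hj : j = 0
  · rw [if_pos hj, abs_zero]
    split_ifs <;> simp
  · have hj0 : (j : ℕ) ≠ 0 := fun h0 => hj (Fin.ext (by simpa using h0))
    have hp : 1 < p := by have := j.isLt; omega
    rw [if_neg hj, dif_pos hp]
    exact hlam (Fin.le_def.2 (Nat.one_le_iff_ne_zero.2 hj0))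

theorem IsRankOneApprox.le_norm_sub {A : 𝔼 →L[ℝ] 𝔼} {s r : ℝ} {h : 𝔼}
    (hap : IsRankOneApprox A s h r) : r ≤ ‖A - signedOuter s h‖ := by
  obtain ⟨lam, w, hA, hlam, rfl, rfl, rfl⟩ := hap
  split_ifs with hp
  · have h1 := (A - signedOuter (Real.sign (lam 0)) (√|lam 0| • w 0)).le_opNorm (w ⟨1, hp⟩)
    have h2 : (⟨1, hp⟩ : Fin p) ≠ 0 := fun h0 => by simpa using congrArg Fin.val h0
    rwa [sub_signedOuter_apply hA, if_neg h2, norm_smul, w.orthonormal.1, mul_one, mul_one,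
      Real.norm_eq_abs] at h1
  · exact norm_nonneg _

/-- At most the first `m` eigenvalues exceed `ε` in magnitude, and deflation removes the first.
Keeping the eigenvectors with indices `1, …, m - 1` gives the new approximant; for `m = 0` it is
zero. -/
theorem IsRankOneApprox.rankApprox_sub {A : 𝔼 →L[ℝ] 𝔼} {s r : ℝ} {h : 𝔼}
    (hap : IsRankOneApprox A s h r) {m : ℕ} {ε : ℝ} (hm : RankApprox m ε A) :
    RankApprox (m - 1) ε (A - signedOuter s h) := by
  classical
  obtain ⟨lam, w, hA, hlam, rfl, rfl, -⟩ := hap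
  have hε : 0 ≤ ε := let ⟨_, _, hR⟩ := hm; (norm_nonneg _).trans hR
  set I : Finset (Fin p) := Finset.univ.filter fun j => j ≠ 0 ∧ (j : ℕ) < m with hI
  have hRw : ∀ j, (∑ i ∈ I, lam i • InnerProductSpace.rankOne ℝ (w i) (w i)) (w j) =
      if j ∈ I then lam j • w j else 0 := by
    intro j
    simp only [sum_apply, smul_apply,
      InnerProductSpace.rankOne_apply, orthonormal_iff_ite.1 w.orthonormal, ite_smul, one_smul,
      zero_smul, smul_ite, smul_zero, Finset.sum_ite_eq']
  refine ⟨∑ i ∈ I, lam i • InnerProductSpace.rankOne ℝ (w i) (w i), ?_, ?_⟩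
  · have hrange : LinearMap.range
        ((∑ i ∈ I, lam i • InnerProductSpace.rankOne ℝ (w i) (w i) : 𝔼 →L[ℝ] 𝔼) : 𝔼 →ₗ[ℝ] 𝔼) ≤
        Submodule.span ℝ (I.image w : Set 𝔼) := by
      rintro _ ⟨v, rfl⟩
      simp only [ContinuousLinearMap.coe_coe, sum_apply,
        smul_apply, InnerProductSpace.rankOne_apply]
      exact Submodule.sum_mem _ fun i hi => Submodule.smul_mem _ _ (Submodule.smul_mem _ _
        (Submodule.subset_span (Finset.mem_coe.2 (Finset.mem_image_of_mem w hi))))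
    refine (Submodule.finrank_mono hrange).trans ((finrank_span_finset_le_card _).trans
      (Finset.card_image_le.trans ?_))
    calc I.card ≤ (Finset.Ico 1 m).card :=
          Finset.card_le_card_of_injOn (fun j => (j : ℕ))
            (fun j hj => by
              obtain ⟨hj0, hjm⟩ := (Finset.mem_filter.1 hj).2
              have : (j : ℕ) ≠ 0 := fun h0 => hj0 (Fin.ext (by simpa using h0))
              exact Finset.mem_coe.2 (Finset.mem_Ico.2 ⟨Nat.one_le_iff_ne_zero.2 this, hjm⟩))
            (fun _ _ _ _ e => Fin.ext e)
      _ = m - 1 := by simp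
  · refine opNorm_le_of_eigenbasis (w := w) (lam := fun j => if m ≤ (j : ℕ) ∧ j ≠ 0 then lam j else 0)
      (fun j => ?_) hε fun j => ?_
    · rw [sub_apply, sub_signedOuter_apply hA, hRw]
      by_cases hj : j = 0 <;> by_cases hjm : m ≤ (j : ℕ) <;> simp [hI, hj, hjm]
      simp [not_le.1 hjm]
    · split_ifs with hj
      · exact hm.abs_eigenvalue_le hA hlam hj.1
      · simpa using hε

/-- Iterating `p` rank-one corrections of a drifting operator leaves an error that is bounded by
the drift. -/
theorem remainder_le_sum_drift {A D : ℕ → 𝔼 →L[ℝ] 𝔼} {s r : ℕ → ℝ} {h : ℕ → 𝔼}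
    (hap : ∀ k, IsRankOneApprox (A k) (s k) (h k) (r k))
    (hA : ∀ k, A (k + 1) = A k - signedOuter (s k) (h k) + D k) (k : ℕ) :
    r (k + p) ≤ ∑ l ∈ Finset.range p, ‖D (k + l)‖ := by
  -- Each iteration trades one unit of rank for one drift term; at `m = p` the rank is zero and a
  -- norm bound remains.
  have key : ∀ m, RankApprox (p - m) (∑ l ∈ Finset.range m, ‖D (k + l)‖)
      (A (k + m) - signedOuter (s (k + m)) (h (k + m))) := by
    intro m
    induction m with
    | zero => simpa using rankApprox_self _
    | succ m ih =>
      rw [Finset.sum_range_succ, ← Nat.sub_sub]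
      refine (hap (k + (m + 1))).rankApprox_sub ?_
      rw [← add_assoc, hA]
      exact ih.add _
  have := key p
  rw [Nat.sub_self] at this
  exact (hap (k + p)).le_norm_sub.trans this.norm_le

end RankOne

/-! ### Gradients and Hessians -/

section Hessian

variable {p : ℕ}

local notation "𝔼" => EuclideanSpace ℝ (Fin p)

theorem contDiff_gradient {F : 𝔼 → ℝ} (hF : ContDiff ℝ 2 F) : ContDiff ℝ 1 (gradient F) :=
  (InnerProductSpace.toDual ℝ 𝔼).symm.contDiff.comp
    (hF.fderiv_right (m := 1) (by norm_num [one_add_one_eq_two]))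

theorem hasFDerivAt_gradient {F : 𝔼 → ℝ} (hF : ContDiff ℝ 2 F) (x : 𝔼) :
    HasFDerivAt (gradient F) (hessian F x) x :=
  ((contDiff_gradient hF).differentiable one_ne_zero x).hasFDerivAt

theorem continuous_hessian {F : 𝔼 → ℝ} (hF : ContDiff ℝ 2 F) : Continuous (hessian F) :=
  (contDiff_gradient hF).continuous_fderiv one_ne_zero

theorem gradient_sum {n : ℕ} {f : Fin n → 𝔼 → ℝ} (hf : ∀ i, ContDiff ℝ 2 (f i)) (x : 𝔼) :
    gradient (fun y => ∑ i, f i y) x = ∑ i, gradient (f i) x := by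
  simp only [gradient]
  rw [fderiv_fun_sum fun i _ => (hf i).differentiable two_ne_zero x, map_sum]

theorem hessian_sum {n : ℕ} {f : Fin n → 𝔼 → ℝ} (hf : ∀ i, ContDiff ℝ 2 (f i)) (x : 𝔼) :
    hessian (fun y => ∑ i, f i y) x = ∑ i, hessian (f i) x := by
  simp only [hessian]
  rw [funext (gradient_sum hf)]
  exact fderiv_fun_sum fun i _ => (contDiff_gradient (hf i)).differentiable one_ne_zero x

theorem hasDerivAt_gradient_line {F : 𝔼 → ℝ} (hF : ContDiff ℝ 2 F) (x d : 𝔼) (t : ℝ) :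
    HasDerivAt (fun t : ℝ => gradient F (x + t • d)) (hessian F (x + t • d) d) t := by
  have h1 : HasDerivAt (fun t : ℝ => x + t • d) d t := by
    simpa using ((hasDerivAt_id t).smul_const d).const_add x
  exact (hasFDerivAt_gradient hF _).comp_hasDerivAt t h1

theorem hasDerivAt_line {F : 𝔼 → ℝ} (hF : ContDiff ℝ 2 F) (x d : 𝔼) (t : ℝ) :
    HasDerivAt (fun t : ℝ => F (x + t • d)) (inner ℝ (gradient F (x + t • d)) d) t := by
  have h1 : HasDerivAt (fun t : ℝ => x + t • d) d t := by
    simpa using ((hasDerivAt_id t).smul_const d).const_add x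
  have h2 := (hF.differentiable two_ne_zero (x + t • d)).hasGradientAt
  exact h2.hasFDerivAt.comp_hasDerivAt t h1

theorem norm_gradient_sub_sub_hessian_le {F : 𝔼 → ℝ} (hF : ContDiff ℝ 2 F) {L : ℝ}
    (hL : ∀ x y, ‖hessian F x - hessian F y‖ ≤ L * ‖x - y‖) (x d : 𝔼) :
    ‖gradient F (x + d) - gradient F x - hessian F x d‖ ≤ L / 2 * ‖d‖ ^ 2 := by
  have hd : ∀ t : ℝ, HasDerivAt (fun t : ℝ => gradient F (x + t • d) - gradient F x -
      t • hessian F x d) (hessian F (x + t • d) d - hessian F x d) t := fun t => by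
    simpa using ((hasDerivAt_gradient_line hF x d t).sub_const (gradient F x)).fun_sub
      ((hasDerivAt_id t).smul_const (hessian F x d))
  have hB : ∀ t : ℝ, HasDerivAt (fun t : ℝ => L / 2 * ‖d‖ ^ 2 * t ^ 2) (L * ‖d‖ ^ 2 * t) t :=
    fun t => by
      have := (hasDerivAt_pow 2 t).const_mul (L / 2 * ‖d‖ ^ 2)
      exact this.congr_deriv (by push_cast; ring)
  have := image_norm_le_of_norm_deriv_right_le_deriv_boundary (a := 0) (b := 1)
    (fun t _ => (hd t).continuousAt.continuousWithinAt)
    (fun t _ => (hd t).hasDerivWithinAt) (by simp) hB (fun t ht => ?_)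
    (Set.right_mem_Icc.2 zero_le_one)
  · simpa using this
  · rw [← sub_apply]
    calc _ ≤ ‖hessian F (x + t • d) - hessian F x‖ * ‖d‖ := ContinuousLinearMap.le_opNorm _ _
      _ ≤ L * ‖x + t • d - x‖ * ‖d‖ := by gcongr; exact hL _ _
      _ = L * ‖d‖ ^ 2 * t := by
        rw [add_sub_cancel_left, norm_smul, Real.norm_eq_abs, abs_of_nonneg ht.1]; ring

theorem monotone_of_hasDerivAt_nonneg {u u' : ℝ → ℝ} (h : ∀ t, HasDerivAt u (u' t) t) {a b : ℝ}
    (hab : a ≤ b) (h0 : ∀ t, a ≤ t → 0 ≤ u' t) : u a ≤ u b := by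
  refine monotoneOn_of_deriv_nonneg (convex_Icc a b)
    (fun t _ => (h t).continuousAt.continuousWithinAt)
    (fun t _ => (h t).differentiableAt.differentiableWithinAt) (fun t ht => ?_)
    (Set.left_mem_Icc.2 hab) (Set.right_mem_Icc.2 hab) hab
  rw [interior_Icc] at ht
  rw [(h t).deriv]
  exact h0 t ht.1.le

variable {F : EuclideanSpace ℝ (Fin p) → ℝ} {μ : ℝ}

theorem le_inner_gradient_sub (hF : ContDiff ℝ 2 F)
    (hμ : ∀ x v, μ * ‖v‖ ^ 2 ≤ inner ℝ (hessian F x v) v) (x d : 𝔼) {t : ℝ} (ht : 0 ≤ t) :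
    t * (μ * ‖d‖ ^ 2) ≤ inner ℝ (gradient F (x + t • d) - gradient F x) d := by
  have hd : ∀ t : ℝ, HasDerivAt (fun t : ℝ => inner ℝ (gradient F (x + t • d)) d -
      t * (μ * ‖d‖ ^ 2)) (inner ℝ (hessian F (x + t • d) d) d - μ * ‖d‖ ^ 2) t := fun t => by
    have h1 := (hasDerivAt_gradient_line hF x d t).inner ℝ (hasDerivAt_const t d)
    simpa using h1.fun_sub ((hasDerivAt_id t).mul_const (μ * ‖d‖ ^ 2))
  have := monotone_of_hasDerivAt_nonneg hd ht fun s _ => sub_nonneg.2 (hμ _ _)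
  simp only [zero_smul, add_zero, zero_mul, sub_zero] at this
  rw [inner_sub_left]
  linarith

theorem add_inner_add_le (hF : ContDiff ℝ 2 F)
    (hμ : ∀ x v, μ * ‖v‖ ^ 2 ≤ inner ℝ (hessian F x v) v) (x d : 𝔼) :
    F x + inner ℝ (gradient F x) d + μ / 2 * ‖d‖ ^ 2 ≤ F (x + d) := by
  have hd : ∀ t : ℝ, HasDerivAt (fun t : ℝ => F (x + t • d) - t * inner ℝ (gradient F x) d -
      μ / 2 * ‖d‖ ^ 2 * t ^ 2) (inner ℝ (gradient F (x + t • d)) d -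
        inner ℝ (gradient F x) d - μ * ‖d‖ ^ 2 * t) t := fun t => by
    have h1 := ((hasDerivAt_line hF x d t).fun_sub
      ((hasDerivAt_id t).mul_const (inner ℝ (gradient F x) d))).fun_sub
        ((hasDerivAt_pow 2 t).const_mul (μ / 2 * ‖d‖ ^ 2))
    exact h1.congr_deriv (by push_cast; ring)
  have := monotone_of_hasDerivAt_nonneg hd zero_le_one fun t ht => by
    have := le_inner_gradient_sub hF hμ x d ht
    rw [inner_sub_left] at this
    linarith
  simp only [zero_smul, add_zero, zero_mul, sub_zero, one_smul, one_mul, one_pow, mul_one] at this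
  rw [zero_pow two_ne_zero, mul_zero, sub_zero] at this
  linarith

theorem norm_sub_le_norm_gradient_div (hμ0 : 0 < μ) (hF : ContDiff ℝ 2 F)
    (hμ : ∀ x v, μ * ‖v‖ ^ 2 ≤ inner ℝ (hessian F x v) v) {xs : 𝔼} (hxs : gradient F xs = 0)
    (x : 𝔼) : ‖x - xs‖ ≤ ‖gradient F x‖ / μ := by
  have h1 := le_inner_gradient_sub hF hμ xs (x - xs) zero_le_one
  rw [one_smul, add_sub_cancel, hxs, sub_zero, one_mul] at h1
  have h2 := real_inner_le_norm (gradient F x) (x - xs)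
  rw [le_div_iff₀ hμ0]
  rcases (norm_nonneg (x - xs)).eq_or_lt with h0 | h0
  · rw [← h0, zero_mul]; exact norm_nonneg _
  · refine le_of_mul_le_mul_right ?_ h0
    linarith

theorem exists_strict_minimizer (hμ0 : 0 < μ) (hF : ContDiff ℝ 2 F)
    (hμ : ∀ x v, μ * ‖v‖ ^ 2 ≤ inner ℝ (hessian F x v) v) :
    ∃ xs, gradient F xs = 0 ∧ ∀ y, y ≠ xs → F xs < F y := by
  obtain ⟨xs, hxs⟩ : ∃ xs, ∀ y, F xs ≤ F y := by
    -- On the sublevel set of `0`, strong convexity gives `μ / 2 * ‖y‖ ^ 2 ≤ ‖gradient F 0‖ * ‖y‖`,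
    -- hence the radius.
    refine hF.continuous.exists_forall_le_of_isBounded 0
      (isBounded_iff_forall_norm_le.2 ⟨2 * ‖gradient F 0‖ / μ, fun y hy => ?_⟩)
    have h1 := add_inner_add_le hF hμ 0 y
    rw [zero_add] at h1
    have h2 := neg_le_of_abs_le (abs_real_inner_le_norm (gradient F 0) y)
    have hy' : F y ≤ F 0 := hy
    rw [le_div_iff₀ hμ0]
    rcases (norm_nonneg y).eq_or_lt with h0 | h0
    · rw [← h0, zero_mul]; positivity
    · refine le_of_mul_le_mul_right ?_ h0
      nlinarith
  have hg : gradient F xs = 0 := by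
    have : IsLocalMin F xs := Filter.Eventually.of_forall hxs
    rw [gradient, this.fderiv_eq_zero, map_zero]
  refine ⟨xs, hg, fun y hy => ?_⟩
  have h1 := add_inner_add_le hF hμ xs (y - xs)
  rw [hg, inner_zero_left, add_zero, add_sub_cancel] at h1
  have : 0 < ‖y - xs‖ := norm_pos_iff.2 (sub_ne_zero.2 hy)
  have : 0 < μ / 2 * ‖y - xs‖ ^ 2 := by positivity
  linarith

/-! ### Inexact damped Newton steps -/

/-- Coercivity of `A` survives the perturbation as `(μ - r) * ‖v‖ ≤ ‖B v‖`, and in finite dimension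
injectivity suffices for invertibility. `B` need not be symmetric. -/
theorem inverse_apply_of_norm_sub_le {A B : 𝔼 →L[ℝ] 𝔼} {r : ℝ} (hr : r < μ)
    (hA : ∀ v, μ * ‖v‖ ^ 2 ≤ inner ℝ (A v) v) (hAB : ‖A - B‖ ≤ r) (g : 𝔼) :
    B (B.inverse g) = g ∧ ‖B.inverse g‖ ≤ ‖g‖ / (μ - r) := by
  have hpos : 0 < μ - r := sub_pos.2 hr
  have hB : ∀ v, (μ - r) * ‖v‖ ≤ ‖B v‖ := by
    intro v
    rcases (norm_nonneg v).eq_or_lt with h0 | h0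
    · rw [← h0, mul_zero]; exact norm_nonneg _
    · have h1 := hA v
      have h2 : inner ℝ (A v) v ≤ ‖A v‖ * ‖v‖ := real_inner_le_norm _ _
      have h3 : ‖(A - B) v‖ ≤ r * ‖v‖ := (A - B).le_of_opNorm_le hAB v
      have h4 : ‖A v‖ ≤ ‖B v‖ + ‖(A - B) v‖ := by
        have : A v = B v + (A - B) v := by simp
        rw [this]; exact norm_add_le _ _
      have h5 : μ * ‖v‖ ≤ ‖A v‖ := by
        refine le_of_mul_le_mul_right ?_ h0
        linarith
      linarith
  have hinj : Function.Injective (B : 𝔼 →ₗ[ℝ] 𝔼) := by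
    rw [injective_iff_map_eq_zero]
    intro v hv
    have h1 := hB v
    have h2 : B v = 0 := hv
    rw [h2, norm_zero] at h1
    exact norm_le_zero_iff.1 (nonpos_of_mul_nonpos_right h1 hpos)
  have hinv : B.IsInvertible := by
    refine ⟨(LinearEquiv.ofInjectiveEndo (B : 𝔼 →ₗ[ℝ] 𝔼) hinj).toContinuousLinearEquiv, ?_⟩
    ext1 v
    rfl
  have h1 : B (B.inverse g) = g := hinv.self_apply_inverse g
  refine ⟨h1, ?_⟩
  rw [le_div_iff₀ hpos]
  have := hB (B.inverse g)
  rw [h1] at this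
  linarith

/-- For the step `d` one has `B d = -a • g`, so the new gradient is `(1 - a) • g`, plus the Hessian
error applied to `d`, plus a Taylor remainder of size `L / 2 * ‖d‖ ^ 2`. -/
theorem norm_gradient_newton_step_le (hF : ContDiff ℝ 2 F)
    (hμ : ∀ x v, μ * ‖v‖ ^ 2 ≤ inner ℝ (hessian F x v) v) {L : ℝ} (hL0 : 0 ≤ L)
    (hL : ∀ x y, ‖hessian F x - hessian F y‖ ≤ L * ‖x - y‖) {r : ℝ} (hr : r < μ) (x : 𝔼)
    {B : 𝔼 →L[ℝ] 𝔼} (hB : ‖hessian F x - B‖ ≤ r) {a : ℝ} (ha0 : 0 ≤ a) (ha1 : a ≤ 1) :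
    ‖gradient F (x - a • B.inverse (gradient F x))‖ ≤
      (1 - a + a * (r / (μ - r) + L * (a * ‖gradient F x‖) / (2 * (μ - r) ^ 2))) *
        ‖gradient F x‖ := by
  set g := gradient F x with hg
  obtain ⟨hBg, hbd⟩ := inverse_apply_of_norm_sub_le hr (hμ x) hB g
  set d := -(a • B.inverse g) with hd
  have hpos : 0 < μ - r := sub_pos.2 hr
  have hr0 : 0 ≤ r := (norm_nonneg _).trans hB
  have hdn : ‖d‖ ≤ a * (‖g‖ / (μ - r)) := by
    rw [hd, norm_neg, norm_smul, Real.norm_eq_abs, abs_of_nonneg ha0]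
    gcongr
  have h1 := norm_gradient_sub_sub_hessian_le hF hL x d
  have h2 : ‖(hessian F x - B) d‖ ≤ r * ‖d‖ := (hessian F x - B).le_of_opNorm_le hB d
  have h3 : gradient F (x + d) = (1 - a) • g + (hessian F x - B) d +
      (gradient F (x + d) - g - hessian F x d) := by
    have : B d = -(a • g) := by rw [hd, map_neg, map_smul, hBg]
    rw [sub_apply, this, sub_smul, one_smul]
    abel
  rw [sub_eq_add_neg, h3]
  have h4 : ‖(1 - a) • g‖ = (1 - a) * ‖g‖ := by
    rw [norm_smul, Real.norm_eq_abs, abs_of_nonneg (by linarith)]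
  calc _ ≤ ‖(1 - a) • g‖ + ‖(hessian F x - B) d‖ +
        ‖gradient F (x + d) - g - hessian F x d‖ := norm_add₃_le
    _ ≤ (1 - a) * ‖g‖ + r * (a * (‖g‖ / (μ - r))) + L / 2 * (a * (‖g‖ / (μ - r))) ^ 2 := by
      rw [h4]
      gcongr
      · exact h2.trans (by gcongr)
      · exact h1.trans (by gcongr)
    _ = _ := by field_simp; ring

end Hessian

/-! ### The constants of the method -/

section Constants

variable {μ L M c : ℝ}

theorem threshold_equation (μ M c : ℝ) :
    3 * threshold μ M c ^ 2 + 2 * (M + c) * threshold μ M c = μ ^ 2 := by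
  have h : √((M + c) ^ 2 + 3 * μ ^ 2) ^ 2 = (M + c) ^ 2 + 3 * μ ^ 2 := Real.sq_sqrt (by positivity)
  unfold threshold
  linear_combination h / 3

theorem threshold_pos (hμ : 0 < μ) : 0 < threshold μ M c := by
  have h : M + c < √((M + c) ^ 2 + 3 * μ ^ 2) :=
    Real.lt_sqrt_of_sq_lt (by nlinarith [sq_pos_of_pos hμ])
  unfold threshold
  linarith

theorem threshold_lt (hμ : 0 < μ) (hM : μ ≤ M) (hc : 0 < c) : threshold μ M c < μ := by
  have h1 := threshold_pos (M := M) (c := c) hμ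
  have h2 := threshold_equation μ M c
  nlinarith [mul_pos h1 hc, mul_nonneg h1.le (sub_nonneg.2 hM)]

theorem phi_eq (hL : 0 < L) (hμ : 0 < μ) (hM : μ ≤ M) :
    phi μ L M c = 2 * (μ - threshold μ M c) / L *
      (μ * (μ - threshold μ M c) / (M + μ) - threshold μ M c) := by
  have : 0 < M + μ := by linarith
  unfold phi
  field_simp

/-- By `threshold_equation`, positivity reduces to `2 * μ < 3 * threshold μ M c + M + 2 * c`. For `c
= 0` and `M = μ` this is an equality and `φ = 0`, which is why `c > 0` is required. -/
theorem phi_pos (hL : 0 < L) (hμ : 0 < μ) (hM : μ ≤ M) (hc : 0 < c) : 0 < phi μ L M c := by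
  have h1 := threshold_pos (M := M) (c := c) hμ
  have h2 := threshold_lt hμ hM hc
  have h3 := threshold_equation μ M c
  have h4 : 2 * μ < 3 * threshold μ M c + M + 2 * c := by
    have : 2 * μ - c < √((M + c) ^ 2 + 3 * μ ^ 2) :=
      Real.lt_sqrt_of_sq_lt (by nlinarith [mul_pos hμ hc])
    unfold threshold
    linarith
  have h5 : threshold μ M c < μ * (μ - threshold μ M c) / (M + μ) := by
    rw [lt_div_iff₀ (by linarith)]
    nlinarith
  rw [phi_eq hL hμ hM]
  have := sub_pos.2 h5
  have := sub_pos.2 h2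
  positivity

/-- The contraction factor of a step of length `φ` with an error at the threshold. -/
theorem step_factor_le (hL : 0 < L) (hμ : 0 < μ) (hM : μ ≤ M) (hc : 0 < c) {r b : ℝ} (_hr0 : 0 ≤ r)
    (hr : r ≤ threshold μ M c) (_hb0 : 0 ≤ b) (hb : b ≤ phi μ L M c) :
    r / (μ - r) + L * b / (2 * (μ - r) ^ 2) ≤ μ / (M + μ) := by
  have h1 := threshold_pos (M := M) (c := c) hμ
  have h2 := threshold_lt hμ hM hc
  have hT : 0 < μ - threshold μ M c := sub_pos.2 h2
  have hMμ : 0 < M + μ := by linarith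
  have hφ := phi_pos hL hμ hM hc
  -- The left side increases in `r` and `b`; `φ` is exactly the value of `b` giving equality at the
  -- threshold.
  calc _ ≤ threshold μ M c / (μ - threshold μ M c) +
        L * phi μ L M c / (2 * (μ - threshold μ M c) ^ 2) := by gcongr
    _ = _ := by
      rw [phi_eq hL hμ hM]
      field_simp
      ring

end Constants

/-! ### Superlinear rates -/

theorem RSuperlinear.of_le {u v : ℕ → ℝ} (hv : RSuperlinear v) (h : ∀ k, |u k| ≤ |v k|) :
    RSuperlinear u :=
  let ⟨e, he, hle⟩ := hv
  ⟨e, he, fun k => (h k).trans (hle k)⟩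

theorem rSuperlinear_of_eventually_le {u b : ℕ → ℝ} (hu : ∀ k, 0 ≤ u k)
    (hb : Filter.Tendsto b Filter.atTop (nhds 0))
    (hub : ∀ᶠ k in Filter.atTop, u (k + 1) ≤ b k * u k) : RSuperlinear u := by
  -- The second entry of the maximum keeps `e` nonzero even if `u` vanishes, and contributes only `1
  -- / (k + 1)` to the ratio.
  let e : ℕ → ℝ := fun k => Nat.rec (max (u 0) 1)
    (fun k y => max (u (k + 1)) (1 / ((k : ℝ) + 1) * y)) k
  have hs : ∀ k, e (k + 1) = max (u (k + 1)) (1 / ((k : ℝ) + 1) * e k) := fun _ => rfl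
  have hpos : ∀ k, 0 < e k := by
    intro k
    induction k with
    | zero => exact lt_max_of_lt_right one_pos
    | succ k ih => rw [hs]; exact lt_max_of_lt_right (by positivity)
  have hle : ∀ k, u k ≤ e k := by
    rintro (_ | k)
    · exact le_max_left _ _
    · rw [hs]; exact le_max_left _ _
  have hratio : Filter.Tendsto (fun k => |e (k + 1)| / |e k|) Filter.atTop (nhds 0) := by
    have hlim : Filter.Tendsto (fun k : ℕ => max |b k| (1 / ((k : ℝ) + 1))) Filter.atTop
        (nhds 0) := by
      simpa using hb.abs.max tendsto_one_div_add_atTop_nhds_zero_nat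
    refine squeeze_zero' (Filter.Eventually.of_forall fun k => by positivity) ?_ hlim
    filter_upwards [hub] with k hk
    rw [abs_of_pos (hpos k), abs_of_pos (hpos (k + 1)), div_le_iff₀ (hpos k), hs]
    refine max_le ?_ (mul_le_mul_of_nonneg_right (le_max_right _ _) (hpos k).le)
    calc u (k + 1) ≤ b k * u k := hk
      _ ≤ |b k| * e k := mul_le_mul (le_abs_self _) (hle k) (hu k) (abs_nonneg _)
      _ ≤ _ := mul_le_mul_of_nonneg_right (le_max_left _ _) (hpos k).le
  refine ⟨e, ⟨fun k => (hpos k).ne', ?_, hratio⟩, fun k => ?_⟩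
  · exact (summable_of_ratio_test_tendsto_lt_one zero_lt_one
      (Filter.Eventually.of_forall fun k => (hpos k).ne') hratio).tendsto_atTop_zero
  · rw [abs_of_nonneg (hu k), abs_of_pos (hpos k)]
    exact hle k

/-! ### Convergence of the inexact damped Newton method -/

section InexactNewton

open Filter Topology

variable {p : ℕ} {F : EuclideanSpace ℝ (Fin p) → ℝ} {μ L M c : ℝ}

theorem stepsize_of_threshold_lt {r : ℝ} (hr : threshold μ M c < r)
    (g : EuclideanSpace ℝ (Fin p)) : stepsize μ L M c r g = 0 :=
  if_neg (not_le.2 hr)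

theorem stepsize_mem_Ioc (hL : 0 < L) (hμ : 0 < μ) (hM : μ ≤ M) (hc : 0 < c) {r : ℝ}
    (hr : r ≤ threshold μ M c) (g : EuclideanSpace ℝ (Fin p)) :
    stepsize μ L M c r g ∈ Set.Ioc 0 1 := by
  have hφ := phi_pos hL hμ hM hc
  rw [stepsize, if_pos hr]
  split_ifs with hg
  · simp
  · have := norm_pos_iff.2 hg
    exact ⟨lt_min one_pos (by positivity), min_le_left _ _⟩

theorem stepsize_mul_norm_le (hL : 0 < L) (hμ : 0 < μ) (hM : μ ≤ M) (hc : 0 < c) (r : ℝ)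
    (g : EuclideanSpace ℝ (Fin p)) : stepsize μ L M c r g * ‖g‖ ≤ phi μ L M c := by
  have hφ := phi_pos hL hμ hM hc
  rw [stepsize]
  split_ifs with hr hg
  · simpa [hg] using hφ.le
  · rw [← le_div_iff₀ (norm_pos_iff.2 hg)]
    exact min_le_right _ _
  · simpa using hφ.le

theorem le_stepsize (hL : 0 < L) (hμ : 0 < μ) (hM : μ ≤ M) (hc : 0 < c) {r : ℝ}
    (hr : r ≤ threshold μ M c) {g : EuclideanSpace ℝ (Fin p)} {b : ℝ} (_hb : 0 < b)
    (hg : ‖g‖ ≤ b) : min 1 (phi μ L M c / b) ≤ stepsize μ L M c r g := by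
  have hφ := phi_pos hL hμ hM hc
  rw [stepsize, if_pos hr]
  split_ifs with hg0
  · exact min_le_left _ _
  · have := norm_pos_iff.2 hg0
    gcongr

/-- Convergence uses only that active steps recur. The hypothesis `hρ` is conditional because the
error can be shown to vanish only once the iterates converge. -/
theorem rSuperlinear_of_inexact_newton (hF : ContDiff ℝ 2 F) (hμ : 0 < μ) (hL : 0 < L)
    (hM : μ ≤ M) (hc : 0 < c) (hμF : ∀ x v, μ * ‖v‖ ^ 2 ≤ inner ℝ (hessian F x v) v)
    (hLF : ∀ x y, ‖hessian F x - hessian F y‖ ≤ L * ‖x - y‖)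
    {xs : EuclideanSpace ℝ (Fin p)} (hxs : gradient F xs = 0)
    {X : ℕ → EuclideanSpace ℝ (Fin p)}
    {B : ℕ → EuclideanSpace ℝ (Fin p) →L[ℝ] EuclideanSpace ℝ (Fin p)} {ρ : ℕ → ℝ}
    (hB : ∀ k, ‖hessian F (X k) - B k‖ ≤ ρ k)
    (hX : ∀ k, ρ k ≤ threshold μ M c → X (k + 1) = X k -
      stepsize μ L M c (ρ k) (gradient F (X k)) • (B k).inverse (gradient F (X k)))
    (hX' : ∀ k, threshold μ M c < ρ k → X (k + 1) = X k)
    (hfreq : ∃ᶠ k in atTop, ρ k ≤ threshold μ M c)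
    (hρ : Tendsto X atTop (𝓝 xs) → Tendsto ρ atTop (𝓝 0)) :
    RSuperlinear fun k => ‖X k - xs‖ := by
  have hφ := phi_pos hL hμ hM hc
  have hT0 := threshold_pos (M := M) (c := c) hμ
  have hTμ := threshold_lt hμ hM hc
  set a : ℕ → ℝ := fun k => stepsize μ L M c (ρ k) (gradient F (X k)) with ha
  set u : ℕ → ℝ := fun k => ‖gradient F (X k)‖ with hu
  set θ : ℝ := μ / (M + μ) with hθ
  have hθ1 : θ < 1 := by
    rw [hθ, div_lt_one (by linarith)]
    linarith
  have hρ0 : ∀ k, 0 ≤ ρ k := fun k => (norm_nonneg _).trans (hB k)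
  have hstep : ∀ k, ρ k ≤ threshold μ M c → u (k + 1) ≤
      (1 - a k + a k * (ρ k / (μ - ρ k) + L * (a k * u k) / (2 * (μ - ρ k) ^ 2))) * u k := by
    intro k hk
    have hak := stepsize_mem_Ioc hL hμ hM hc hk (gradient F (X k))
    simp only [hu]
    rw [hX k hk]
    exact norm_gradient_newton_step_le hF hμF hL.le hLF (hk.trans_lt hTμ) (X k) (hB k)
      hak.1.le hak.2
  have hcontr : ∀ k, ρ k ≤ threshold μ M c → u (k + 1) ≤ (1 - a k * (1 - θ)) * u k := by
    intro k hk
    have hak := stepsize_mem_Ioc hL hμ hM hc hk (gradient F (X k))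
    have h1 := step_factor_le hL hμ hM hc (hρ0 k) hk (mul_nonneg hak.1.le (norm_nonneg _))
      (stepsize_mul_norm_le hL hμ hM hc (ρ k) (gradient F (X k)))
    refine (hstep k hk).trans (mul_le_mul_of_nonneg_right ?_ (norm_nonneg _))
    have h2 := mul_le_mul_of_nonneg_left h1 hak.1.le
    simp only [ha, hu, hθ]
    linarith
  have hanti : Antitone u := by
    refine antitone_nat_of_succ_le fun k => ?_
    rcases le_or_gt (ρ k) (threshold μ M c) with hk | hk
    · have hak := stepsize_mem_Ioc hL hμ hM hc hk (gradient F (X k))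
      refine (hcontr k hk).trans (mul_le_of_le_one_left (norm_nonneg _) ?_)
      have := mul_nonneg hak.1.le (sub_nonneg.2 hθ1.le)
      simp only [ha]
      linarith
    · simp only [hu]
      rw [hX' k hk]
  have hu0 : Tendsto u atTop (𝓝 0) := by
    have hbdd : BddBelow (Set.range u) := ⟨0, by rintro _ ⟨k, rfl⟩; exact norm_nonneg _⟩
    have hlim := tendsto_atTop_ciInf hanti hbdd
    set l := ⨅ k, u k
    have hl0 : 0 ≤ l := le_ciInf fun k => norm_nonneg _
    have hb : 0 < u 0 + 1 := add_pos_of_nonneg_of_pos (norm_nonneg _) one_pos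
    -- A uniform lower bound for active stepsizes, since the gradient norm never exceeds `u 0`; the
    -- `+ 1` keeps the denominator positive.
    set q := min 1 (phi μ L M c / (u 0 + 1)) with hq
    have hq0 : 0 < q := lt_min one_pos (by positivity)
    have hlim' : Tendsto (fun k => u (k + 1) - (1 - q * (1 - θ)) * u k) atTop
        (𝓝 (l - (1 - q * (1 - θ)) * l)) :=
      (hlim.comp (tendsto_add_atTop_nat 1)).sub (hlim.const_mul _)
    -- The contraction holds only along the active steps, but the whole sequence converges, so its
    -- limit satisfies `l ≤ (1 - q * (1 - θ)) * l`.
    have hle := le_of_tendsto_of_frequently hlim' (b := 0) <| hfreq.mono fun k hk => by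
      have h1 : q ≤ a k := le_stepsize hL hμ hM hc hk hb
        ((hanti (Nat.zero_le k)).trans (by linarith))
      have h2 := hcontr k hk
      have h3 : (1 - a k * (1 - θ)) * u k ≤ (1 - q * (1 - θ)) * u k := by
        have := sub_nonneg.2 hθ1.le
        have : 0 ≤ u k := norm_nonneg _
        gcongr
      linarith
    have hpos : 0 < q * (1 - θ) := mul_pos hq0 (sub_pos.2 hθ1)
    have hl : l = 0 := by nlinarith
    rwa [hl] at hlim
  have hdist : ∀ k, ‖X k - xs‖ ≤ u k / μ := fun k =>
    norm_sub_le_norm_gradient_div hμ hF hμF hxs (X k)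
  have hXlim : Tendsto X atTop (𝓝 xs) := by
    rw [tendsto_iff_norm_sub_tendsto_zero]
    exact squeeze_zero (fun _ => norm_nonneg _) hdist (by simpa using hu0.div_const μ)
  have hρlim := hρ hXlim
  have hsuper : RSuperlinear fun k => u k / μ := by
    refine rSuperlinear_of_eventually_le
      (b := fun k => ρ k / (μ - ρ k) + L * u k / (2 * (μ - ρ k) ^ 2))
      (fun k => div_nonneg (norm_nonneg _) hμ.le) ?_ ?_
    · have h1 : Tendsto (fun k => μ - ρ k) atTop (𝓝 μ) := by simpa using hρlim.const_sub μ
      have h2 := (hρlim.div h1 hμ.ne').add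
        ((hu0.const_mul L).div ((h1.pow 2).const_mul 2) (by positivity))
      simpa using h2
    · filter_upwards [hρlim.eventually_le_const hT0, hu0.eventually_le_const hφ] with k hk huk
      have hak : a k = 1 := by
        simp only [ha]
        rw [stepsize, if_pos hk]
        split_ifs with hg
        · rfl
        · exact min_eq_left ((one_le_div (norm_pos_iff.2 hg)).2 huk)
      have h1 := hstep k hk
      rw [hak] at h1
      rw [← mul_div_assoc]
      refine div_le_div_of_nonneg_right (h1.trans (le_of_eq ?_)) hμ.le
      ring
  refine hsuper.of_le fun k => ?_
  rw [abs_norm]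
  exact (hdist k).trans (le_abs_self _)

end InexactNewton

/-! ### Executions of the algorithm -/

namespace DANLA

open Filter Topology

variable {n p : ℕ} [NeZero p] {ι : Type*} {G : Digraph (Fin n)} {P : Protocol G}
  {ident : Fin n → ι} {f : Fin n → EuclideanSpace ℝ (Fin p) → ℝ} {μ L M c : ℝ}
  {x₀ : EuclideanSpace ℝ (Fin p)}

section Consensus

variable (hG : StronglyConnected G) (hident : Function.Injective ident)
  (R : DANLA P ident f μ L M c x₀)

include hG hident

theorem sum_known {E : Type*} [AddCommMonoid E] (φ : ι × Message p → E) (k : ℕ) (i : Fin n) :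
    ∑ m ∈ R.known k P.rounds i, φ m =
      ∑ l, φ (ident l, ⟨R.r k l, R.s k l, R.g k l, R.h k l⟩) :=
  (R.flooding k).sum_known_rounds (fun _ _ h => hident (congrArg Prod.fst h)) hG φ i

theorem ghat_eq_sum (k : ℕ) (i : Fin n) : R.ghat k i = ∑ l, R.g k l := by
  rw [R.ghat_eq, R.sum_known hG hident fun m => m.2.g]

theorem rhat_eq_sum (k : ℕ) (i : Fin n) : R.rhat k i = ∑ l, R.r k l := by
  rw [R.rhat_eq, R.sum_known hG hident fun m => m.2.r]

theorem Hhat_eq_sum (k : ℕ) (i : Fin n) : R.Hhat k i = ∑ l, R.H k l := by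
  induction k with
  | zero => simp [R.Hhat_zero, R.H_zero]
  | succ k ih =>
    rw [R.Hhat_succ, R.sum_known hG hident fun m => signedOuter m.2.s m.2.h, ih,
      ← Finset.sum_add_distrib]
    exact Finset.sum_congr rfl fun l _ => (R.H_succ k l).symm

theorem x_eq (k : ℕ) (i j : Fin n) : R.x k i = R.x k j := by
  induction k with
  | zero => rw [R.x_zero, R.x_zero]
  | succ k ih =>
    simp only [R.x_succ, R.α_eq, R.rhat_eq_sum hG hident, R.ghat_eq_sum hG hident,
      R.Hhat_eq_sum hG hident, ih]

end Consensus

theorem rSuperlinear (hG : StronglyConnected G) (hident : Function.Injective ident)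
    (R : DANLA P ident f μ L M c x₀) (hf : ∀ i, ContDiff ℝ 2 (f i)) (hμ : 0 < μ) (hL : 0 < L)
    (hM : μ ≤ M) (hc : 0 < c)
    (hμf : ∀ x v, μ * ‖v‖ ^ 2 ≤ inner ℝ (hessian (fun y => ∑ i, f i y) x v) v)
    (hLf : ∀ x y, ‖hessian (fun y => ∑ i, f i y) x - hessian (fun y => ∑ i, f i y) y‖ ≤
      L * ‖x - y‖)
    {xs : EuclideanSpace ℝ (Fin p)} (hxs : gradient (fun y => ∑ i, f i y) xs = 0) (i : Fin n) :
    RSuperlinear fun k => ‖R.x k i - xs‖ := by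
  have hT0 := threshold_pos (M := M) (c := c) hμ
  have hghat : ∀ k, R.ghat k i = gradient (fun y => ∑ i, f i y) (R.x k i) := fun k => by
    rw [R.ghat_eq_sum hG hident, gradient_sum hf]
    exact Finset.sum_congr rfl fun l _ => by rw [R.g_eq, R.x_eq hG hident k l i]
  have hap : ∀ l k, IsRankOneApprox (hessian (f l) (R.x k i) - R.H k l) (R.s k l) (R.h k l)
      (R.r k l) := fun l k => R.x_eq hG hident k l i ▸ R.rankOne k l
  have hdrift : ∀ k l, R.r (k + p) l ≤ ∑ m ∈ Finset.range p,
      ‖hessian (f l) (R.x (k + m + 1) i) - hessian (f l) (R.x (k + m) i)‖ := fun k l =>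
    remainder_le_sum_drift (hap l) (fun k => by rw [R.H_succ]; abel)
      (D := fun k => hessian (f l) (R.x (k + 1) i) - hessian (f l) (R.x k i)) k
  have hr0 : ∀ k l, 0 ≤ R.r k l := fun k l => (norm_nonneg _).trans (hap l k).norm_sub_le
  have hα0 : ∀ k, threshold μ M c < R.rhat k i → R.x (k + 1) i = R.x k i := fun k hk => by
    rw [R.x_succ, R.α_eq, stepsize_of_threshold_lt hk, if_pos rfl]
  refine rSuperlinear_of_inexact_newton (B := fun k => R.Hhat (k + 1) i)
    (ρ := fun k => R.rhat k i) (ContDiff.sum fun i _ => hf i) hμ hL hM hc hμf hLf hxs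
    (fun k => ?_) (fun k hk => ?_) hα0 (fun hev => ?_) fun hx => ?_
  · rw [hessian_sum hf, R.Hhat_eq_sum hG hident, R.rhat_eq_sum hG hident,
      ← Finset.sum_sub_distrib]
    refine norm_sum_le_of_le _ fun l _ => ?_
    rw [R.H_succ, ← sub_sub]
    exact (hap l k).norm_sub_le
  · rw [← hghat, ← R.α_eq, R.x_succ, if_neg]
    rw [R.α_eq]
    exact (stepsize_mem_Ioc hL hμ hM hc hk _).1.ne'
  -- If all iterations from `K` on were idle, the iterate would be constant and all drift terms
  -- zero, so `rhat (K + p)` would lie below the positive threshold.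
  · obtain ⟨K, hK⟩ := eventually_atTop.1 hev
    refine hK (K + p) (Nat.le_add_right K p) ?_
    change R.rhat (K + p) i ≤ threshold μ M c
    rw [R.rhat_eq_sum hG hident]
    refine (Finset.sum_nonpos fun l _ => (hdrift K l).trans (le_of_eq ?_)).trans hT0.le
    refine Finset.sum_eq_zero fun m _ => ?_
    rw [hα0 (K + m) (not_le.1 (hK (K + m) (Nat.le_add_right K m))), sub_self, norm_zero]
  -- Continuity of the local Hessians is enough here; the Lipschitz bound concerns only their sum.
  · have hD : ∀ l m, Tendsto (fun k => ‖hessian (f l) (R.x (k + m + 1) i) -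
        hessian (f l) (R.x (k + m) i)‖) atTop (𝓝 0) := fun l m => by
      have h1 := ((continuous_hessian (hf l)).tendsto xs).comp hx
      have h2 := ((h1.comp (tendsto_add_atTop_nat (m + 1))).sub
        (h1.comp (tendsto_add_atTop_nat m))).norm
      rw [sub_self, norm_zero] at h2
      exact h2
    have hsum : Tendsto (fun k => R.rhat (k + p) i) atTop (𝓝 0) := by
      have h1 : Tendsto (fun k => ∑ l, ∑ m ∈ Finset.range p,
          ‖hessian (f l) (R.x (k + m + 1) i) - hessian (f l) (R.x (k + m) i)‖) atTop (𝓝 0) := by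
        simpa using tendsto_finsetSum Finset.univ fun l _ =>
          tendsto_finsetSum (Finset.range p) fun m _ => hD l m
      refine squeeze_zero (fun k => ?_) (fun k => ?_) h1
      · rw [R.rhat_eq_sum hG hident]
        exact Finset.sum_nonneg fun l _ => hr0 _ l
      · rw [R.rhat_eq_sum hG hident]
        exact Finset.sum_le_sum fun l _ => hdrift k l
    exact (tendsto_add_atTop_iff_nat p).1 hsum

end DANLA

end DistributedNewton

theorem theorem3 {n p : ℕ} [NeZero p]
    -- local objective functions
    (f : Fin n → EuclideanSpace ℝ (Fin p) → ℝ)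
    (hf : ∀ i, ContDiff ℝ 2 (f i))
    {μ L M : ℝ} (hμ : 0 < μ) (hL : 0 < L)
    -- the sum of the local objectives is `μ`-strongly convex
    (hμf : ∀ x v, μ * ‖v‖ ^ 2 ≤
      inner ℝ (DistributedNewton.hessian (fun y => ∑ i, f i y) x v) v)
    -- with `L`-Lipschitz Hessian
    (hLf : ∀ x y, ‖DistributedNewton.hessian (fun y => ∑ i, f i y) x -
      DistributedNewton.hessian (fun y => ∑ i, f i y) y‖ ≤ L * ‖x - y‖)
    -- bounded above by `M I`
    (hMf : ∀ x v,
      inner ℝ (DistributedNewton.hessian (fun y => ∑ i, f i y) x v) v ≤ M * ‖v‖ ^ 2)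
    -- a strongly connected network whose nodes have unique identifiers
    (G : Digraph (Fin n)) (hG : DistributedNewton.StronglyConnected G)
    (P : DistributedNewton.Protocol G)
    {ι : Type*} (ident : Fin n → ι) (hident : Function.Injective ident)
    {c : ℝ} (hc : 0 < c) (x₀ : EuclideanSpace ℝ (Fin p)) :
    -- there is a unique optimal point, to which every execution converges at every node
    ∃ xs : EuclideanSpace ℝ (Fin p),
      (∀ y, y ≠ xs → ∑ i, f i xs < ∑ i, f i y) ∧
      ∀ (R : DistributedNewton.DANLA P ident f μ L M c x₀) (i : Fin n),
        DistributedNewton.RSuperlinear (fun k => ‖R.x k i - xs‖) := by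
  -- Compare the two Hessian bounds at a unit vector, which exists since `p ≥ 1`.
  have hM : μ ≤ M := by
    have h := (hμf 0 (EuclideanSpace.single 0 1)).trans (hMf 0 (EuclideanSpace.single 0 1))
    simpa using h
  obtain ⟨xs, hxs, hmin⟩ :=
    DistributedNewton.exists_strict_minimizer hμ (ContDiff.sum fun i _ => hf i) hμf
  exact ⟨xs, hmin, fun R i => R.rSuperlinear hG hident hf hμ hL hM hc hμf hLf hxs i⟩
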